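/- Let $G$ be a (finite-dimensional) Lie group acting smoothly on the left on a (finite-dimensional) smooth manifold $Q$ without boundary, in such a way that the quotient map $\pi:Q\to Q/G$ is a smooth principal $G$-bundle; write $gq$ for the action of $g\in G$ on $q\in Q$. A \emph{discrete connection} on $\pi$ is an embedded submanifold $Hor\subset Q\times Q$ that contains the diagonal, is invariant under the diagonal $G$-action, and is such that $(\mathrm{id}_Q\times\pi)|_{Hor}:Hor\to Q\times (Q/G)$ is an injective local diffeomorphism. Its \emph{domain} is $\mathfrak U:=\{(q_0,gq_1): (q_0,q_1)\in Hor,\ g\in G\}$. Its \emph{associated discrete connection form} is the map $\mathcal A_d:\mathfrak U\to G$ that sends $(q_0,q_1)$ to the element $g\in G$ for which $(q_0,g^{-1}q_1)\in Hor$. A \emph{discrete connection form} on $\pi$ is a smooth map $\mathcal A:\mathcal U\to G$, where $\mathcal U\subset Q\times Q$ is open, contains the diagonal and is invariant under the product $G\times G$-action, such that $\mathcal A(q,q)=e$ for all $q\in Q$ and $$\mathcal A(g_0q_0,g_1q_1)=g_1\,\mathcal A(q_0,q_1)\,g_0^{-1}\qquad\text{for all }(q_0,q_1)\in\mathcal U,\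 g_0,g_1\in G.$$ \textbf{Theorem.} (1) Let $Hor$ be a discrete connection on $\pi$ with domain $\mathfrak U$. Then for every $(q_0,q_1)\in\mathfrak U$ there is exactly one $g\in G$ with $(q_0,g^{-1}q_1)\in Hor$, so that $\mathcal A_d$ is well defined; $\mathcal A_d:\mathfrak U\to G$ is a discrete connection form (in particular, $\mathfrak U$ is open and $G\times G$-invariant and $\mathcal A_d$ is smooth); and $Hor=\{(q_0,q_1)\in\mathfrak U:\mathcal A_d(q_0,q_1)=e\}$. (2) Conversely, let $\mathcal A:\mathcal U\to G$ be a discrete connection form on $\pi$. Then $Hor:=\{(q_0,q_1)\in\mathcal U:\mathcal A(q_0,q_1)=e\}$ is a discrete connection on $\pi$, its domain is $\mathcal U$, and its associated discrete connection form is $\mathcal A$. -/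

import Mathlib

open scoped Manifold ContDiff

noncomputable section

namespace DiscreteConnection

section Bundle

variable {G Q : Type*} [Group G] [MulAction G Q]

/-- The orbit space `Q / G`; it carries the quotient topology. -/
abbrev OrbitSpace (G Q : Type*) [Group G] [MulAction G Q] : Type _ :=
  MulAction.orbitRel.Quotient G Q

/-- The quotient map `π : Q → Q / G`. -/
def proj (G : Type*) {Q : Type*} [Group G] [MulAction G Q] (q : Q) : OrbitSpace G Q :=
  Quotient.mk (MulAction.orbitRel G Q) q

/-- The quotient map `π : Q → Q / G` of a (left) action is a smooth principal `G`-bundle: around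
each point of `Q / G` there is a local trivialization `π ⁻¹ (V) → V × G` over `V` which is a
diffeomorphism and is equivariant, where `G` acts on `V × G` by left multiplication on the
second factor. (In particular `π` is smooth and the action is free.) -/
def IsPrincipalBundle
    {EG HG EQ HQ EB HB : Type*}
    [NormedAddCommGroup EG] [NormedSpace ℝ EG] [TopologicalSpace HG]
    [NormedAddCommGroup EQ] [NormedSpace ℝ EQ] [TopologicalSpace HQ]
    [NormedAddCommGroup EB] [NormedSpace ℝ EB] [TopologicalSpace HB]
    (IG : ModelWithCorners ℝ EG HG) (IQ : ModelWithCorners ℝ EQ HQ)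
    (IB : ModelWithCorners ℝ EB HB)
    (G Q : Type*) [Group G] [MulAction G Q]
    [TopologicalSpace G] [ChartedSpace HG G] [TopologicalSpace Q] [ChartedSpace HQ Q]
    [ChartedSpace HB (OrbitSpace G Q)] : Prop :=
  ∀ b : OrbitSpace G Q, ∃ e : Bundle.Trivialization G (proj G : Q → OrbitSpace G Q),
    b ∈ e.baseSet ∧
    ContMDiffOn IQ (IB.prod IG) ∞ e e.source ∧
    ContMDiffOn (IB.prod IG) IQ ∞ e.toOpenPartialHomeomorph.symm e.target ∧
    ∀ q ∈ e.source, ∀ g : G, e (g • q) = (proj G q, g * (e q).2)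

/-- The action of `G` on the second factor of `Q × Q`. It is also the composition of the
vertical pair `(q₀, g • q₀)` with a pair `(q₀, q₁)`, that is `(q₀, g • q₁)`. -/
def smulSnd (g : G) (p : Q × Q) : Q × Q := (p.1, g • p.2)

/-- The map `id × π : Q × Q → Q × (Q / G)`. -/
def idProdProj (G : Type*) {Q : Type*} [Group G] [MulAction G Q] (p : Q × Q) :
    Q × OrbitSpace G Q :=
  (p.1, proj G p.2)

/-- `Hor ⊆ Q × Q` defines a discrete connection on `π : Q → Q / G`: it is an embedded
submanifold, invariant under the diagonal action, which contains the diagonal and on which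
`id × π` is an injective local diffeomorphism into `Q × (Q / G)`. -/
structure IsDiscreteConnection
    {EQ HQ EB HB : Type*}
    [NormedAddCommGroup EQ] [NormedSpace ℝ EQ] [TopologicalSpace HQ]
    [NormedAddCommGroup EB] [NormedSpace ℝ EB] [TopologicalSpace HB]
    (IQ : ModelWithCorners ℝ EQ HQ) (IB : ModelWithCorners ℝ EB HB)
    (G : Type*) {Q : Type*} [Group G] [MulAction G Q]
    [TopologicalSpace Q] [ChartedSpace HQ Q] [ChartedSpace HB (OrbitSpace G Q)]
    (Hor : Set (Q × Q)) : Prop where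
  invariant : ∀ (g : G) (q₀ q₁ : Q), (q₀, q₁) ∈ Hor → (g • q₀, g • q₁) ∈ Hor
  diagonal : ∀ q : Q, (q, q) ∈ Hor
  /-- `Hor`, with its subspace topology, carries a manifold structure for which the inclusion is
  a smooth embedding and the restriction of `id × π` is a local diffeomorphism. -/
  submanifold : ∃ (k : ℕ) (_ : ChartedSpace (EuclideanSpace ℝ (Fin k)) Hor),
    IsManifold (𝓡 k) ∞ Hor ∧
    Manifold.IsSmoothEmbedding (𝓡 k) (IQ.prod IQ) ∞ (Subtype.val : Hor → Q × Q) ∧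
    IsLocalDiffeomorph (𝓡 k) (IQ.prod IB) ∞ (fun p : Hor => idProdProj G (p : Q × Q))
  injective : Set.InjOn (idProdProj G) Hor

/-- The domain `{(q₀, g • q₁) : (q₀, q₁) ∈ Hor, g ∈ G}` of a discrete connection. -/
def domain (G : Type*) {Q : Type*} [Group G] [MulAction G Q] (Hor : Set (Q × Q)) :
    Set (Q × Q) :=
  {p | ∃ r ∈ Hor, ∃ g : G, p = smulSnd g r}

/-- `g` is the vertical part of the pair `(q₀, q₁)`: the pair decomposes as the composition of
the vertical pair `(q₀, g • q₀)` with the pair `(q₀, g⁻¹ • q₁)`, which lies in `Hor`. -/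
def IsVerticalPart (Hor : Set (Q × Q)) (p : Q × Q) (g : G) : Prop :=
  (p.1, g⁻¹ • p.2) ∈ Hor ∧ p = smulSnd g (p.1, g⁻¹ • p.2)

open Classical in
/-- The discrete connection form associated to `Hor`: on the domain it sends a pair to its
vertical part. The value `1` outside of the domain is a placeholder. -/
def form (G : Type*) {Q : Type*} [Group G] [MulAction G Q] (Hor : Set (Q × Q)) (p : Q × Q) : G :=
  if h : ∃ g : G, IsVerticalPart Hor p g then h.choose else 1

/-- `A : U → G` is a discrete connection form (only the values of `A` on `U` matter). -/
structure IsDiscreteConnectionForm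
    {EG HG EQ HQ : Type*}
    [NormedAddCommGroup EG] [NormedSpace ℝ EG] [TopologicalSpace HG]
    [NormedAddCommGroup EQ] [NormedSpace ℝ EQ] [TopologicalSpace HQ]
    (IG : ModelWithCorners ℝ EG HG) (IQ : ModelWithCorners ℝ EQ HQ)
    {G Q : Type*} [Group G] [MulAction G Q]
    [TopologicalSpace G] [ChartedSpace HG G] [TopologicalSpace Q] [ChartedSpace HQ Q]
    (U : Set (Q × Q)) (A : Q × Q → G) : Prop where
  isOpen : IsOpen U
  diagonal : ∀ q : Q, (q, q) ∈ U
  invariant : ∀ (g₀ g₁ : G) (q₀ q₁ : Q), (q₀, q₁) ∈ U → (g₀ • q₀, g₁ • q₁) ∈ U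
  smooth : ContMDiffOn (IQ.prod IQ) IG ∞ A U
  normalized : ∀ q : Q, A (q, q) = 1
  equivariant : ∀ (g₀ g₁ : G) (q₀ q₁ : Q), (q₀, q₁) ∈ U →
    A (g₀ • q₀, g₁ • q₁) = g₁ * A (q₀, q₁) * g₀⁻¹

end Bundle

end DiscreteConnection

end

/-! The fibres of `idProdProj G` are the `G`-orbits in the second factor. A discrete connection
meets each fibre at most once and the action is free, so the vertical part is unique. The domain is
the preimage of an open image. For smoothness, a local inverse of `idProdProj G` on `Hor` picks a
point of `Hor` in the same fibre, and the vertical part is a quotient of `G`-coordinates in a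
trivialization (`contMDiffOn_form`).

Conversely, equivariance makes `A` a coordinate along these fibres, so `(q₀, q₁) ↦ (q₀, π q₁, A (q₀,
q₁))` is a local diffeomorphism whose inverse is explicit in a trivialization
(`exists_partialDiffeomorph`). No inverse function theorem is needed. The level set `A = 1` is a
slice, so `idProdProj G` embeds it openly in `Q × (Q / G)`. The manifold structure pulled back along
this embedding makes the inclusion an immersion. -/

noncomputable section

open Set Topology

/-! ### Partial diffeomorphisms and the charts they define -/

namespace PartialDiffeomorph

variable {𝕜 : Type*} [NontriviallyNormedField 𝕜]
  {E H F HN E' : Type*}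
  [NormedAddCommGroup E] [NormedSpace 𝕜 E] [TopologicalSpace H]
  [NormedAddCommGroup F] [NormedSpace 𝕜 F] [TopologicalSpace HN]
  [NormedAddCommGroup E'] [NormedSpace 𝕜 E']
  {I : ModelWithCorners 𝕜 E H} {J : ModelWithCorners 𝕜 F HN}
  {M N : Type*} [TopologicalSpace M] [ChartedSpace H M] [TopologicalSpace N] [ChartedSpace HN N]
  {n : ℕ∞ω}

/-- The extended chart at a point of a boundaryless manifold, as a partial diffeomorphism. -/
def extChart (I : ModelWithCorners 𝕜 E H) [I.Boundaryless] [IsManifold I n M] (x : M) :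
    PartialDiffeomorph I 𝓘(𝕜, E) M E n where
  toPartialEquiv := extChartAt I x
  open_source := isOpen_extChartAt_source x
  open_target := isOpen_extChartAt_target x
  contMDiffOn_toFun := by
    rw [extChartAt_source]
    exact contMDiffOn_extChartAt
  contMDiffOn_invFun := contMDiffOn_extChartAt_symm x

/-- A boundaryless model with corners, as a partial diffeomorphism. -/
def ofModel (I : ModelWithCorners 𝕜 E H) [I.Boundaryless] (n : ℕ∞ω) :
    PartialDiffeomorph I 𝓘(𝕜, E) H E n where
  toPartialEquiv := I.toHomeomorph.toPartialEquiv
  open_source := isOpen_univ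
  open_target := isOpen_univ
  contMDiffOn_toFun := I.contMDiff.contMDiffOn
  contMDiffOn_invFun := I.contMDiffOn_symm.mono (by simp [I.range_eq_univ])

/-- The product of two partial diffeomorphisms. -/
def prodMap {E₁ H₁ E₂ H₂ : Type*}
    [NormedAddCommGroup E₁] [NormedSpace 𝕜 E₁] [TopologicalSpace H₁]
    [NormedAddCommGroup E₂] [NormedSpace 𝕜 E₂] [TopologicalSpace H₂]
    {I₁ : ModelWithCorners 𝕜 E₁ H₁} {I₂ : ModelWithCorners 𝕜 E₂ H₂}
    {M₁ M₂ : Type*} [TopologicalSpace M₁] [ChartedSpace H₁ M₁]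
    [TopologicalSpace M₂] [ChartedSpace H₂ M₂]
    (Φ : PartialDiffeomorph I J M N n) (Ψ : PartialDiffeomorph I₁ I₂ M₁ M₂ n) :
    PartialDiffeomorph (I.prod I₁) (J.prod I₂) (M × M₁) (N × M₂) n where
  toPartialEquiv := Φ.toPartialEquiv.prod Ψ.toPartialEquiv
  open_source := Φ.open_source.prod Ψ.open_source
  open_target := Φ.open_target.prod Ψ.open_target
  contMDiffOn_toFun := Φ.contMDiffOn_toFun.prodMap Ψ.contMDiffOn_toFun
  contMDiffOn_invFun := Φ.contMDiffOn_invFun.prodMap Ψ.contMDiffOn_invFun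

/-- A linear isomorphism, as a partial diffeomorphism. -/
def ofLinear (L : E ≃L[𝕜] E') (n : ℕ∞ω) : PartialDiffeomorph 𝓘(𝕜, E) 𝓘(𝕜, E') E E' n where
  toPartialEquiv := L.toEquiv.toPartialEquiv
  open_source := isOpen_univ
  open_target := isOpen_univ
  contMDiffOn_toFun := L.contDiff.contMDiff.contMDiffOn
  contMDiffOn_invFun := L.symm.contDiff.contMDiff.contMDiffOn

/-- An affine isomorphism from a product of vector spaces, as a partial diffeomorphism. -/
def affineProd (L : (E × F) ≃L[𝕜] E') (c : E × F) (n : ℕ∞ω) :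
    PartialDiffeomorph (𝓘(𝕜, E).prod 𝓘(𝕜, F)) 𝓘(𝕜, E') (E × F) E' n where
  toFun v := L (v - c)
  invFun w := L.symm w + c
  source := univ
  target := univ
  map_source' _ _ := mem_univ _
  map_target' _ _ := mem_univ _
  left_inv' _ _ := by simp
  right_inv' _ _ := by simp
  open_source := isOpen_univ
  open_target := isOpen_univ
  contMDiffOn_toFun := by
    rw [← modelWithCornersSelf_prod, chartedSpaceSelf_prod]
    exact (L.contDiff.comp (contDiff_id.sub contDiff_const)).contMDiff.contMDiffOn
  contMDiffOn_invFun := by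
    rw [← modelWithCornersSelf_prod, chartedSpaceSelf_prod]
    exact (L.symm.contDiff.add contDiff_const).contMDiff.contMDiffOn

/-- The chart of a boundaryless manifold given by a partial diffeomorphism to the model vector
space. -/
def toChart [I.Boundaryless] (Φ : PartialDiffeomorph I 𝓘(𝕜, E) M E n) :
    OpenPartialHomeomorph M H :=
  (Φ.trans (ofModel I n).symm).toOpenPartialHomeomorph

theorem toChart_mem_maximalAtlas [I.Boundaryless] [IsManifold I n M]
    (Φ : PartialDiffeomorph I 𝓘(𝕜, E) M E n) : Φ.toChart ∈ IsManifold.maximalAtlas I n M :=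
  OpenPartialHomeomorph.mem_maximalAtlas_of_contMDiffOn _
    (Φ.trans (ofModel I n).symm).contMDiffOn_toFun
    (Φ.trans (ofModel I n).symm).contMDiffOn_invFun

theorem toChart_source [I.Boundaryless] (Φ : PartialDiffeomorph I 𝓘(𝕜, E) M E n) :
    Φ.toChart.source = Φ.source := by
  ext x
  exact ⟨fun h => h.1, fun h => ⟨h, mem_univ _⟩⟩

theorem toChart_extend_apply [I.Boundaryless] (Φ : PartialDiffeomorph I 𝓘(𝕜, E) M E n) (x : M) :
    Φ.toChart.extend I x = Φ x :=
  I.right_inv (I.range_eq_univ ▸ mem_univ _)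

end PartialDiffeomorph

/-! ### Manifold structure pulled back along an open embedding -/

namespace Topology.IsOpenEmbedding

variable {𝕜 : Type*} [NontriviallyNormedField 𝕜]
  {F HN E : Type*} [NormedAddCommGroup F] [NormedSpace 𝕜 F] [TopologicalSpace HN]
  [NormedAddCommGroup E] [NormedSpace 𝕜 E]
  {J : ModelWithCorners 𝕜 F HN}
  {X N : Type*} [TopologicalSpace X] [TopologicalSpace N] [ChartedSpace HN N]
  {n : ℕ∞ω} {φ : X → N}

/-- The open partial homeomorphism of an open embedding, with a point in its source. -/
def openPartialHomeomorphAt (hφ : IsOpenEmbedding φ) (x : X) : OpenPartialHomeomorph X N :=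
  haveI : Nonempty X := ⟨x⟩
  hφ.toOpenPartialHomeomorph φ

/-- The charted space structure pulled back along an open embedding into a manifold, with charts
given by partial diffeomorphisms to a vector space. -/
@[reducible]
def chartedSpacePullback (hφ : IsOpenEmbedding φ) (D : N → PartialDiffeomorph J 𝓘(𝕜, E) N E n)
    (hD : ∀ y, y ∈ (D y).source) : ChartedSpace E X where
  atlas := range fun x =>
    (hφ.openPartialHomeomorphAt x).trans (D (φ x)).toOpenPartialHomeomorph
  chartAt x := (hφ.openPartialHomeomorphAt x).trans (D (φ x)).toOpenPartialHomeomorph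
  mem_chart_source x := ⟨mem_univ _, hD (φ x)⟩
  chart_mem_atlas x := mem_range_self x

/-- In a change of charts `φ` cancels against its local inverse, leaving a restriction of the
transition map between two of the `D y`. -/
theorem isManifold_pullback (hφ : IsOpenEmbedding φ)
    (D : N → PartialDiffeomorph J 𝓘(𝕜, E) N E n) (hD : ∀ y, y ∈ (D y).source) :
    letI := hφ.chartedSpacePullback D hD
    IsManifold 𝓘(𝕜, E) n X := by
  let _ := hφ.chartedSpacePullback D hD
  apply isManifold_of_contDiffOn
  rintro _ _ ⟨x, rfl⟩ ⟨y, rfl⟩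
  have h := ((D (φ x)).symm.trans (D (φ y))).contMDiffOn_toFun.contDiffOn
  simp only [mfld_simps]
  have key : ∀ u ∈ ((hφ.openPartialHomeomorphAt x).trans (D (φ x)).toOpenPartialHomeomorph).target,
      φ ((hφ.openPartialHomeomorphAt x).symm ((D (φ x)).symm u)) = (D (φ x)).symm u :=
    fun u hu => (hφ.openPartialHomeomorphAt x).right_inv hu.2
  refine (h.mono ?_).congr ?_
  · rintro u ⟨hu, hu'⟩
    refine ⟨hu.1, ?_⟩
    have := hu'.2
    have e := key u hu
    change φ ((hφ.openPartialHomeomorphAt x).symm ((D (φ x)).symm u)) ∈ (D (φ y)).source at this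
    rw [e] at this
    exact this
  · rintro u ⟨hu, hu'⟩
    exact congrArg (D (φ y)) (key u hu)

theorem isLocalDiffeomorph_pullback (hφ : IsOpenEmbedding φ)
    (D : N → PartialDiffeomorph J 𝓘(𝕜, E) N E n) (hD : ∀ y, y ∈ (D y).source) :
    letI := hφ.chartedSpacePullback D hD
    IsLocalDiffeomorph 𝓘(𝕜, E) J n φ := by
  let _ := hφ.chartedSpacePullback D hD
  have := hφ.isManifold_pullback D hD
  intro x
  set c := chartAt E x with hc
  let C : PartialDiffeomorph 𝓘(𝕜, E) 𝓘(𝕜, E) X E n :=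
    { toPartialEquiv := c.toPartialEquiv
      open_source := c.open_source
      open_target := c.open_target
      contMDiffOn_toFun := contMDiffOn_chart
      contMDiffOn_invFun := contMDiffOn_chart_symm }
  refine ⟨C.trans (D (φ x)).symm, ⟨mem_chart_source E x, ?_⟩, ?_⟩
  · exact (D (φ x)).map_source (hD _)
  · rintro y ⟨hy, -⟩
    exact ((D (φ x)).left_inv hy.2).symm

end Topology.IsOpenEmbedding

/-! ### Immersions from slices -/

namespace Manifold

variable {𝕜 : Type*} [NontriviallyNormedField 𝕜]
  {EX EM HM EN HN EG HG : Type*} [NormedAddCommGroup EX] [NormedSpace 𝕜 EX]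
  [NormedAddCommGroup EM] [NormedSpace 𝕜 EM] [TopologicalSpace HM]
  [NormedAddCommGroup EN] [NormedSpace 𝕜 EN] [TopologicalSpace HN]
  [NormedAddCommGroup EG] [NormedSpace 𝕜 EG] [TopologicalSpace HG]
  {IM : ModelWithCorners 𝕜 EM HM} {IN : ModelWithCorners 𝕜 EN HN} {IG : ModelWithCorners 𝕜 EG HG}
  {X M N G : Type*} [TopologicalSpace X] [ChartedSpace EX X] [TopologicalSpace M]
  [ChartedSpace HM M] [TopologicalSpace N] [ChartedSpace HN N] [TopologicalSpace G]
  [ChartedSpace HG G] {n : ℕ∞ω}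

/-- A map whose image is locally the slice `{g₀}` of a partial diffeomorphism to a product, such
that the first component is a local diffeomorphism, is an immersion. -/
theorem isImmersionAtOfComplement_of_slice [IM.Boundaryless] [IN.Boundaryless] [IG.Boundaryless]
    [IsManifold IM n M] [IsManifold IN n N] [IsManifold IG n G] [IsManifold 𝓘(𝕜, EX) n X]
    {f : X → M} {φ : X → N} {x : X} (hf : ContinuousAt f x)
    (hφ : IsLocalDiffeomorphAt 𝓘(𝕜, EX) IN n φ x)
    (Ψ : PartialDiffeomorph IM (IN.prod IG) M (N × G) n) (hx : f x ∈ Ψ.source) (g₀ : G)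
    (hΨ : ∀ y, f y ∈ Ψ.source → Ψ (f y) = (φ y, g₀))
    (LN : EN ≃L[𝕜] EX) (L : (EX × EG) ≃L[𝕜] EM) :
    IsImmersionAtOfComplement EG 𝓘(𝕜, EX) IM n f x := by
  obtain ⟨Φ, hxΦ, hΦ⟩ := hφ
  -- `hΨ` applies only where `f` lands in `Ψ.source`, so the chart on `X` is later restricted to
  -- `V`.
  obtain ⟨V, hV, hVo, hxV⟩ :=
    mem_nhds_iff.mp (hf.preimage_mem_nhds (Ψ.open_source.mem_nhds hx))
  let DN := (PartialDiffeomorph.extChart (n := n) IN (φ x)).trans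
    (PartialDiffeomorph.ofLinear LN n)
  let DG := PartialDiffeomorph.extChart (n := n) IG g₀
  let C := Φ.trans DN
  -- The same `DN` is used on both sides, so `f` reads as the identity in the first factor.
  -- Subtracting the coordinate of `g₀` sends the slice to `0`, giving the normal form `u ↦ L (u,
  -- 0)`.
  let Ψ' := (Ψ.trans (DN.prodMap DG)).trans
    (PartialDiffeomorph.affineProd L (0, extChartAt IG g₀ g₀) n)
  have hΦx : Φ x = φ x := (hΦ hxΦ).symm
  have hDN : ∀ y ∈ (extChartAt IN (φ x)).source, y ∈ DN.source := fun y hy => ⟨hy, mem_univ _⟩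
  refine IsImmersionAtOfComplement.mk_of_continuousAt hf L (C.toChart.restr V) Ψ'.toChart
    ⟨?_, ?_⟩ ?_ (restr_mem_maximalAtlas _ C.toChart_mem_maximalAtlas hVo)
    Ψ'.toChart_mem_maximalAtlas ?_
  · rw [C.toChart_source]
    refine ⟨hxΦ, hDN _ ?_⟩
    change Φ x ∈ _
    rw [hΦx]
    exact mem_extChartAt_source _
  · rwa [hVo.interior_eq]
  · rw [Ψ'.toChart_source]
    refine ⟨⟨hx, ?_⟩, mem_univ _⟩
    change Ψ (f x) ∈ (DN.prodMap DG).source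
    rw [hΨ x hx]
    exact ⟨hDN _ (mem_extChartAt_source _), mem_extChartAt_source _⟩
  · intro u hu
    set E := (C.toChart.restr V).extend 𝓘(𝕜, EX) with hE
    have hy : E.symm u ∈ E.source := E.map_target hu
    have hr : E (E.symm u) = u := E.right_inv hu
    set y := E.symm u
    have hyV : y ∈ (C.toChart.restr V).source := by
      rwa [hE, OpenPartialHomeomorph.extend_source] at hy
    have hyC : y ∈ C.source := by
      have := hyV.1
      rwa [C.toChart_source] at this
    have hyf : f y ∈ Ψ.source := by
      have := hyV.2
      rw [hVo.interior_eq] at this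
      exact hV this
    have hCy : C y = u := (C.toChart_extend_apply y).symm.trans hr
    change Ψ'.toChart.extend IM (f y) = L (u, 0)
    rw [Ψ'.toChart_extend_apply]
    change L ((DN (Ψ (f y)).1, DG (Ψ (f y)).2) - (0, extChartAt IG g₀ g₀)) = L (u, 0)
    rw [hΨ y hyf, ← hCy, hΦ hyC.1]
    simp [DG, C, PartialDiffeomorph.extChart, PartialDiffeomorph.trans]

end Manifold

namespace DiscreteConnection

/-! ### Orbits, domains and vertical parts -/

section Algebra

variable {G Q : Type*} [Group G] [MulAction G Q]

theorem proj_smul (g : G) (q : Q) : proj G (g • q) = proj G q :=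
  Quotient.sound (s := MulAction.orbitRel G Q) ⟨g, rfl⟩

theorem exists_smul_of_proj_eq {q q' : Q} (h : proj G q = proj G q') : ∃ g : G, g • q' = q :=
  Quotient.exact (s := MulAction.orbitRel G Q) h

theorem mem_domain_iff {Hor : Set (Q × Q)} {p : Q × Q} :
    p ∈ domain G Hor ↔ ∃ g : G, (p.1, g⁻¹ • p.2) ∈ Hor := by
  constructor
  · rintro ⟨r, hr, g, rfl⟩
    exact ⟨g, by simpa [smulSnd] using hr⟩
  · rintro ⟨g, hg⟩
    exact ⟨_, hg, g, by simp [smulSnd]⟩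

theorem isVerticalPart_iff {Hor : Set (Q × Q)} {p : Q × Q} {g : G} :
    IsVerticalPart Hor p g ↔ (p.1, g⁻¹ • p.2) ∈ Hor := by
  simp [IsVerticalPart, smulSnd]

theorem domain_eq_preimage (Hor : Set (Q × Q)) :
    domain G Hor = idProdProj G ⁻¹' (idProdProj G '' Hor) := by
  ext ⟨a, b⟩
  rw [mem_domain_iff]
  constructor
  · rintro ⟨g, hg⟩
    exact ⟨_, hg, Prod.ext rfl (proj_smul _ _)⟩
  · rintro ⟨⟨a', c⟩, hr, h⟩
    obtain ⟨g, hg⟩ := exists_smul_of_proj_eq (congrArg Prod.snd h).symm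
    obtain rfl : a' = a := congrArg Prod.fst h
    change g • c = b at hg
    exact ⟨g, by simpa [← hg] using hr⟩

theorem form_mem {Hor : Set (Q × Q)} {p : Q × Q} (hp : p ∈ domain G Hor) :
    (p.1, (form G Hor p)⁻¹ • p.2) ∈ Hor := by
  have h : ∃ g : G, IsVerticalPart Hor p g := by
    simpa only [isVerticalPart_iff] using mem_domain_iff.mp hp
  rw [form, dif_pos h]
  exact h.choose_spec.1

end Algebra

/-! ### Consequences of local triviality -/

variable {EG HG EQ HQ EB HB : Type*}
  [NormedAddCommGroup EG] [NormedSpace ℝ EG] [TopologicalSpace HG]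
  [NormedAddCommGroup EQ] [NormedSpace ℝ EQ] [TopologicalSpace HQ]
  [NormedAddCommGroup EB] [NormedSpace ℝ EB] [TopologicalSpace HB]
  {IG : ModelWithCorners ℝ EG HG} {IQ : ModelWithCorners ℝ EQ HQ} {IB : ModelWithCorners ℝ EB HB}
  {G Q : Type*} [Group G] [TopologicalSpace G] [ChartedSpace HG G]
  [TopologicalSpace Q] [ChartedSpace HQ Q] [MulAction G Q] [ChartedSpace HB (OrbitSpace G Q)]

theorem IsPrincipalBundle.smul_left_injective (hπ : IsPrincipalBundle IG IQ IB G Q) (q : Q) :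
    Function.Injective fun g : G => g • q := by
  intro g h hgh
  obtain ⟨e, hb, -, -, he⟩ := hπ (proj G q)
  have hq : q ∈ e.source := e.mem_source.mpr hb
  have := (he q hq g).symm.trans ((congrArg e hgh).trans (he q hq h))
  exact mul_right_cancel (congrArg Prod.snd this)

theorem IsPrincipalBundle.contMDiff_proj (hπ : IsPrincipalBundle IG IQ IB G Q) :
    ContMDiff IQ IB ∞ (proj G : Q → OrbitSpace G Q) := by
  intro q
  obtain ⟨e, hb, he, -, -⟩ := hπ (proj G q)
  have hq : q ∈ e.source := e.mem_source.mpr hb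
  refine (contMDiffAt_fst.comp q
    (he.contMDiffAt (e.open_source.mem_nhds hq))).congr_of_eventuallyEq ?_
  exact (e.coe_fst_eventuallyEq_proj hq).symm

theorem IsPrincipalBundle.contMDiff_idProdProj (hπ : IsPrincipalBundle IG IQ IB G Q) :
    ContMDiff (IQ.prod IQ) (IQ.prod IB) ∞ (idProdProj G : Q × Q → Q × OrbitSpace G Q) :=
  contMDiff_fst.prodMk (hπ.contMDiff_proj.comp contMDiff_snd)

/-- The derivative of a trivialization at `q`. It supplies the linear splitting needed for the
immersion. -/
theorem IsPrincipalBundle.nonempty_continuousLinearEquiv (hπ : IsPrincipalBundle IG IQ IB G Q)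
    (q : Q) : Nonempty (EQ ≃L[ℝ] EB × EG) := by
  obtain ⟨e, hb, he, he', -⟩ := hπ (proj G q)
  have hq : q ∈ e.source := e.mem_source.mpr hb
  let Φ : PartialDiffeomorph IQ (IB.prod IG) Q (OrbitSpace G Q × G) ∞ :=
    { toPartialEquiv := e.toPartialEquiv
      open_source := e.open_source
      open_target := e.open_target
      contMDiffOn_toFun := he
      contMDiffOn_invFun := he' }
  exact ⟨(Φ.isLocalDiffeomorphAt _ _ _ hq).mfderivToContinuousLinearEquiv (by simp)⟩

/-! ### From a discrete connection to its form -/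

section ConnectionToForm

variable {Hor : Set (Q × Q)}

theorem IsDiscreteConnection.eq_of_mem (hπ : IsPrincipalBundle IG IQ IB G Q)
    (hH : IsDiscreteConnection IQ IB G Hor) {q₀ q₁ : Q} {g h : G}
    (hg : (q₀, g⁻¹ • q₁) ∈ Hor) (hh : (q₀, h⁻¹ • q₁) ∈ Hor) : g = h := by
  have := hH.injective hg hh (Prod.ext rfl ((proj_smul _ _).trans (proj_smul _ _).symm))
  exact inv_injective (hπ.smul_left_injective q₁ (congrArg Prod.snd this))

theorem IsDiscreteConnection.form_eq (hπ : IsPrincipalBundle IG IQ IB G Q)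
    (hH : IsDiscreteConnection IQ IB G Hor) {q₀ q₁ : Q} {g : G}
    (hg : (q₀, g⁻¹ • q₁) ∈ Hor) : form G Hor (q₀, q₁) = g :=
  hH.eq_of_mem hπ (form_mem (mem_domain_iff.mpr ⟨g, hg⟩)) hg

theorem IsDiscreteConnection.isOpen_domain (hπ : IsPrincipalBundle IG IQ IB G Q)
    (hH : IsDiscreteConnection IQ IB G Hor) : IsOpen (domain G Hor) := by
  obtain ⟨k, _, _, -, hloc⟩ := hH.submanifold
  rw [domain_eq_preimage]
  refine IsOpen.preimage hπ.contMDiff_idProdProj.continuous ?_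
  have := hloc.isOpen_range
  rwa [image_eq_range]

theorem IsDiscreteConnection.contMDiffOn_form [LieGroup IG ∞ G]
    (hπ : IsPrincipalBundle IG IQ IB G Q) (hH : IsDiscreteConnection IQ IB G Hor) :
    ContMDiffOn (IQ.prod IQ) IG ∞ (form G Hor) (domain G Hor) := by
  obtain ⟨k, _, _, hemb, hloc⟩ := hH.submanifold
  rintro p hp
  obtain ⟨r, hr, hrp⟩ := (domain_eq_preimage (G := G) Hor).subset hp
  obtain ⟨Φ, hΦr, hΦ⟩ := hloc ⟨r, hr⟩
  obtain ⟨e, hb, he, -, heq⟩ := hπ (proj G p.2)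
  have hΦp : Φ ⟨r, hr⟩ = idProdProj G p := (hΦ hΦr).symm.trans hrp
  have hpt : idProdProj G p ∈ Φ.target := hΦp ▸ Φ.map_source hΦr
  -- Near `p`, `σ (q₀, q₁)` is the point of `Hor` over `(q₀, π q₁)`.
  let σ : Q × Q → Q × Q := fun p => (Φ.symm (idProdProj G p) : Hor)
  have hσ : ContMDiffAt (IQ.prod IQ) (IQ.prod IQ) ∞ σ p :=
    hemb.contMDiff.contMDiffAt.comp p <|
      (Φ.symm.contMDiffOn.contMDiffAt (Φ.open_target.mem_nhds hpt)).comp p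
        hπ.contMDiff_idProdProj.contMDiffAt
  have hσ_eq : ∀ p', idProdProj G p' ∈ Φ.target → idProdProj G (σ p') = idProdProj G p' :=
    fun p' hp' => (hΦ (Φ.map_target hp')).trans (Φ.right_inv hp')
  have hp_source : p.2 ∈ e.source := e.mem_source.mpr hb
  have hσp_source : (σ p).2 ∈ e.source := by
    rw [e.mem_source, show proj G (σ p).2 = proj G p.2 from congrArg Prod.snd (hσ_eq p hpt)]
    exact hb
  have he2 : ∀ q ∈ e.source, ContMDiffAt IQ IG ∞ (fun q => (e q).2) q := fun q hq =>
    contMDiffAt_snd.comp q (he.contMDiffAt (e.open_source.mem_nhds hq))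
  -- If `p'.2 = g • (σ p').2`, equivariance of `e` makes `g` this quotient of `G`-coordinates.
  have hsmooth : ContMDiffAt (IQ.prod IQ) IG ∞
      (fun p' : Q × Q => (e p'.2).2 * ((e (σ p').2).2)⁻¹) p :=
    ((he2 _ hp_source).comp p contMDiffAt_snd).mul
      (((he2 _ hσp_source).comp p (contMDiffAt_snd.comp p hσ)).inv)
  refine (hsmooth.congr_of_eventuallyEq ?_).contMDiffWithinAt
  have h1 : ∀ᶠ p' in 𝓝 p, idProdProj G p' ∈ Φ.target :=
    hπ.contMDiff_idProdProj.continuous.continuousAt.preimage_mem_nhds (Φ.open_target.mem_nhds hpt)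
  have h2 : ∀ᶠ p' : Q × Q in 𝓝 p, p'.2 ∈ e.source :=
    continuousAt_snd.preimage_mem_nhds (e.open_source.mem_nhds hp_source)
  filter_upwards [h1, h2] with p' hp'1 hp'2
  have hs := hσ_eq p' hp'1
  obtain ⟨g, hg⟩ := exists_smul_of_proj_eq (congrArg Prod.snd hs).symm
  change g • (σ p').2 = p'.2 at hg
  have hmem : (σ p').2 ∈ e.source := by
    rw [e.mem_source, show proj G (σ p').2 = proj G p'.2 from congrArg Prod.snd hs]
    exact e.mem_source.mp hp'2
  have hform : form G Hor p' = g := by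
    refine hH.form_eq hπ (q₀ := p'.1) (q₁ := p'.2) ?_
    rw [← hg, inv_smul_smul, ← show (σ p').1 = p'.1 from (Prod.ext_iff.mp hs).1]
    exact (Φ.symm (idProdProj G p')).2
  rw [hform, ← hg, heq _ hmem]
  simp

theorem IsDiscreteConnection.isDiscreteConnectionForm [LieGroup IG ∞ G]
    (hπ : IsPrincipalBundle IG IQ IB G Q) (hH : IsDiscreteConnection IQ IB G Hor) :
    IsDiscreteConnectionForm IG IQ (domain G Hor) (form G Hor) := by
  -- The second component simplifies to `g₀ • (form G Hor (q₀, q₁))⁻¹ • q₁`, so diagonal invariance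
  -- suffices.
  have key : ∀ (g₀ g₁ : G) (q₀ q₁ : Q), (q₀, q₁) ∈ domain G Hor →
      (g₀ • q₀, (g₁ * form G Hor (q₀, q₁) * g₀⁻¹)⁻¹ • g₁ • q₁) ∈ Hor := by
    intro g₀ g₁ q₀ q₁ h
    simpa [mul_smul] using hH.invariant g₀ _ _ (form_mem h)
  exact
    { isOpen := hH.isOpen_domain hπ
      diagonal := fun q => mem_domain_iff.mpr ⟨1, by simpa using hH.diagonal q⟩
      invariant := fun g₀ g₁ q₀ q₁ h => mem_domain_iff.mpr ⟨_, key g₀ g₁ q₀ q₁ h⟩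
      smooth := hH.contMDiffOn_form hπ
      normalized := fun q => hH.form_eq hπ (by simpa using hH.diagonal q)
      equivariant := fun g₀ g₁ q₀ q₁ h => hH.form_eq hπ (key g₀ g₁ q₀ q₁ h) }

theorem IsDiscreteConnection.eq_setOf_form_eq_one (hπ : IsPrincipalBundle IG IQ IB G Q)
    (hH : IsDiscreteConnection IQ IB G Hor) :
    Hor = {p ∈ domain G Hor | form G Hor p = 1} := by
  ext ⟨q₀, q₁⟩
  constructor
  · intro h
    exact ⟨mem_domain_iff.mpr ⟨1, by simpa using h⟩, hH.form_eq hπ (by simpa using h)⟩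
  · rintro ⟨h, h1⟩
    simpa [h1] using form_mem h

end ConnectionToForm

/-! ### From a discrete connection form to its horizontal set -/

section FormToConnection

variable {EG HG EQ HQ EB HB : Type*}
  [NormedAddCommGroup EG] [NormedSpace ℝ EG] [TopologicalSpace HG]
  [NormedAddCommGroup EQ] [NormedSpace ℝ EQ] [TopologicalSpace HQ]
  [NormedAddCommGroup EB] [NormedSpace ℝ EB] [TopologicalSpace HB]
  {IG : ModelWithCorners ℝ EG HG} {IQ : ModelWithCorners ℝ EQ HQ} {IB : ModelWithCorners ℝ EB HB}
  {G Q : Type*} [Group G] [TopologicalSpace G] [ChartedSpace HG G]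
  [TopologicalSpace Q] [ChartedSpace HQ Q] [MulAction G Q]
  {U : Set (Q × Q)} {A : Q × Q → G}

namespace IsDiscreteConnectionForm

theorem mem_iff_of_proj_eq (hA : IsDiscreteConnectionForm IG IQ U A) {a b b' : Q}
    (h : proj G b = proj G b') : (a, b) ∈ U ↔ (a, b') ∈ U := by
  have key : ∀ {b b' : Q}, proj G b = proj G b' → (a, b') ∈ U → (a, b) ∈ U := by
    intro b b' h hb
    obtain ⟨g, rfl⟩ := exists_smul_of_proj_eq h
    simpa using hA.invariant 1 g _ _ hb
  exact ⟨key h.symm, key h⟩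

theorem smul_snd (hA : IsDiscreteConnectionForm IG IQ U A) (g : G) {a b : Q} (h : (a, b) ∈ U) :
    A (a, g • b) = g * A (a, b) := by
  simpa using hA.equivariant 1 g _ _ h

/-- Equivariance gives `A (a, g⁻¹ • b) = g⁻¹ * A (a, b)`. Both the domain and the associated form
are read off from this. -/
theorem inv_smul_mem_iff (hA : IsDiscreteConnectionForm IG IQ U A) {a b : Q} (g : G) :
    (a, g⁻¹ • b) ∈ {p ∈ U | A p = 1} ↔ (a, b) ∈ U ∧ A (a, b) = g := by
  have hU : (a, g⁻¹ • b) ∈ U ↔ (a, b) ∈ U := hA.mem_iff_of_proj_eq (proj_smul _ _)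
  rw [mem_ofPred_eq, hU]
  refine and_congr_right fun h => ?_
  rw [hA.smul_snd _ h, inv_mul_eq_one, eq_comm]

theorem domain_eq (hA : IsDiscreteConnectionForm IG IQ U A) :
    domain G {p ∈ U | A p = 1} = U := by
  ext ⟨a, b⟩
  rw [mem_domain_iff]
  simp only [hA.inv_smul_mem_iff]
  exact ⟨fun ⟨_, h, _⟩ => h, fun h => ⟨_, h, rfl⟩⟩

theorem eqOn_form (hA : IsDiscreteConnectionForm IG IQ U A) :
    EqOn (form G {p ∈ U | A p = 1}) A U := by
  rintro ⟨a, b⟩ h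
  rw [← hA.domain_eq] at h
  exact ((hA.inv_smul_mem_iff _).mp (form_mem h)).2.symm

theorem injOn_idProdProj (hA : IsDiscreteConnectionForm IG IQ U A) :
    InjOn (idProdProj G) {p ∈ U | A p = 1} := by
  rintro ⟨a, b⟩ ⟨hb, hb1⟩ ⟨a', b'⟩ ⟨hb', hb1'⟩ h
  obtain rfl : a = a' := congrArg Prod.fst h
  obtain ⟨g, rfl⟩ := exists_smul_of_proj_eq (congrArg Prod.snd h)
  change A (a, g • b') = 1 at hb1
  rw [hA.smul_snd _ hb', hb1', mul_one] at hb1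
  simp [hb1]

variable [ChartedSpace HB (OrbitSpace G Q)]

/-- In a local trivialization of the bundle, `(q₀, q₁) ↦ (q₀, π q₁, A (q₀, q₁))` is a partial
diffeomorphism. -/
theorem exists_partialDiffeomorph [LieGroup IG ∞ G] (hπ : IsPrincipalBundle IG IQ IB G Q)
    (hA : IsDiscreteConnectionForm IG IQ U A) {p : Q × Q} (hp : p ∈ U) :
    ∃ Ψ : PartialDiffeomorph (IQ.prod IQ) ((IQ.prod IB).prod IG) (Q × Q)
      ((Q × OrbitSpace G Q) × G) ∞, p ∈ Ψ.source ∧ Ψ.source ⊆ U ∧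
      ∀ r, Ψ r = (idProdProj G r, A r) := by
  obtain ⟨e, hb, he, hes, heq⟩ := hπ (proj G p.2)
  -- The local section of `π` with `G`-coordinate `1`; the fibre over `c` consists of the points `h
  -- • s c`.
  let s : OrbitSpace G Q → Q := fun c => e.toOpenPartialHomeomorph.symm (c, 1)
  have hsmem : ∀ c ∈ e.baseSet, s c ∈ e.source := fun c hc =>
    e.map_target (e.mem_target.mpr hc)
  have hproj : ∀ c ∈ e.baseSet, proj G (s c) = c := fun c hc => e.proj_symm_apply' hc
  have hsmul : ∀ c ∈ e.baseSet, ∀ h : G,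
      e.toOpenPartialHomeomorph.symm (c, h) = h • s c := by
    intro c hc h
    have h1 : h • s c ∈ e.source := by
      rw [e.mem_source, proj_smul, hproj c hc]
      exact hc
    have h2 : e (h • s c) = (c, h) := by
      rw [heq _ (hsmem c hc), hproj c hc, show e (s c) = (c, 1) from e.apply_symm_apply' hc]
      simp
    rw [← h2]
    exact e.toOpenPartialHomeomorph.left_inv h1
  let τ : Set (Q × OrbitSpace G Q) :=
    {x | x.2 ∈ e.baseSet} ∩ (fun x => (x.1, s x.2)) ⁻¹' U
  have hs : ContMDiffOn IB IQ ∞ s e.baseSet :=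
    hes.comp (contMDiffOn_id.prodMk contMDiffOn_const) fun c hc => e.mem_target.mpr hc
  have hs' : ContMDiffOn (IQ.prod IB) (IQ.prod IQ) ∞
      (fun x : Q × OrbitSpace G Q => (x.1, s x.2)) {x | x.2 ∈ e.baseSet} :=
    contMDiffOn_fst.prodMk (hs.comp contMDiffOn_snd fun _ hx => hx)
  have hτ : IsOpen τ :=
    hs'.continuousOn.isOpen_inter_preimage (e.open_baseSet.preimage continuous_snd) hA.isOpen
  have hAs : ContMDiffOn (IQ.prod IB) IG ∞ (fun x : Q × OrbitSpace G Q => A (x.1, s x.2)) τ :=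
    hA.smooth.comp (hs'.mono inter_subset_left) inter_subset_right
  have hmemU : ∀ a b, proj G b ∈ e.baseSet → ((a, s (proj G b)) ∈ U ↔ (a, b) ∈ U) :=
    fun a b h => hA.mem_iff_of_proj_eq (hproj _ h)
  refine ⟨{
    toFun := fun r => (idProdProj G r, A r)
    -- Since `A (a, h • s c) = h * A (a, s c)`, the value `g` is attained at `h = g * (A (a, s
    -- c))⁻¹`.
    invFun := fun x => (x.1.1, e.toOpenPartialHomeomorph.symm
      (x.1.2, x.2 * (A (x.1.1, s x.1.2))⁻¹))
    source := U ∩ Prod.snd ⁻¹' e.source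
    target := τ ×ˢ univ
    map_source' := ?_
    map_target' := ?_
    left_inv' := ?_
    right_inv' := ?_
    open_source := hA.isOpen.inter (e.open_source.preimage continuous_snd)
    open_target := hτ.prod isOpen_univ
    contMDiffOn_toFun :=
      hπ.contMDiff_idProdProj.contMDiffOn.prodMk (hA.smooth.mono inter_subset_left)
    contMDiffOn_invFun := ?_ }, ⟨hp, e.mem_source.mpr hb⟩, inter_subset_left, fun _ => rfl⟩
  · rintro ⟨a, b⟩ ⟨hU, hb⟩
    have hb' : proj G b ∈ e.baseSet := e.mem_source.mp hb
    exact ⟨⟨hb', (hmemU a b hb').mpr hU⟩, mem_univ _⟩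
  · rintro ⟨⟨a, c⟩, g⟩ ⟨⟨hc, hU⟩, -⟩
    refine ⟨?_, e.map_target (e.mem_target.mpr hc)⟩
    dsimp only
    rw [hsmul c hc]
    exact (hA.mem_iff_of_proj_eq (proj_smul _ _)).mpr hU
  · rintro ⟨a, b⟩ ⟨hU, hb⟩
    have hb' : proj G b ∈ e.baseSet := e.mem_source.mp hb
    obtain ⟨g, hg⟩ := exists_smul_of_proj_eq (hproj _ hb').symm
    have hsU : (a, s (proj G b)) ∈ U := (hmemU a b hb').mpr hU
    refine Prod.ext rfl ?_
    change e.toOpenPartialHomeomorph.symm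
      (proj G b, A (a, b) * (A (a, s (proj G b)))⁻¹) = b
    have hAb : A (a, b) = g * A (a, s (proj G b)) := by
      rw [← hA.smul_snd g hsU, hg]
    rw [hAb, mul_inv_cancel_right, hsmul _ hb', hg]
  · rintro ⟨⟨a, c⟩, g⟩ ⟨⟨hc, hU⟩, -⟩
    change (a, s c) ∈ U at hU
    change ((a, proj G _), A (a, _)) = ((a, c), g)
    dsimp only
    rw [hsmul c hc, proj_smul, hproj c hc, hA.smul_snd _ hU, inv_mul_cancel_right]
  · have hfst : ContMDiffOn ((IQ.prod IB).prod IG) (IQ.prod IB) ∞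
        (Prod.fst : (Q × OrbitSpace G Q) × G → _) (τ ×ˢ univ) := contMDiffOn_fst
    have hA' : ContMDiffOn ((IQ.prod IB).prod IG) IG ∞
        (fun x : (Q × OrbitSpace G Q) × G => A (x.1.1, s x.1.2)) (τ ×ˢ univ) :=
      hAs.comp hfst fun x hx => hx.1
    refine (contMDiff_fst.comp_contMDiffOn hfst).prodMk (hes.comp
      ((contMDiff_snd.comp_contMDiffOn hfst).prodMk (contMDiffOn_snd.mul hA'.inv)) ?_)
    exact fun x hx => e.mem_target.mpr hx.1.1

/-- Freezing the last coordinate of `Ψ.symm` at `1` gives a continuous local inverse with values in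
the level set, whence openness. -/
theorem isOpenEmbedding_idProdProj [LieGroup IG ∞ G] (hπ : IsPrincipalBundle IG IQ IB G Q)
    (hA : IsDiscreteConnectionForm IG IQ U A) :
    IsOpenEmbedding fun p : {p ∈ U | A p = 1} => idProdProj G (p : Q × Q) := by
  refine .of_continuous_injective_isOpenMap
    (hπ.contMDiff_idProdProj.continuous.comp continuous_subtype_val)
    (fun p p' h => Subtype.ext (hA.injOn_idProdProj p.2 p'.2 h)) ?_
  refine IsOpenMap.of_nhds_le fun p S hS => ?_
  obtain ⟨V, hV, hVS⟩ := mem_nhds_subtype _ _ _ |>.mp hS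
  obtain ⟨Ψ, hp, hΨU, hΨ⟩ := hA.exists_partialDiffeomorph hπ p.2.1
  have hΨp : Ψ p = (idProdProj G p, 1) := by rw [hΨ, p.2.2]
  have hpt : (idProdProj G (p : Q × Q), (1 : G)) ∈ Ψ.target := hΨp ▸ Ψ.map_source hp
  have hs : ContinuousAt (fun x => Ψ.symm (x, (1 : G))) (idProdProj G (p : Q × Q)) :=
    ContinuousAt.comp (g := Ψ.symm)
      (Ψ.symm.contMDiffOn.continuousOn.continuousAt (Ψ.open_target.mem_nhds hpt))
      (by fun_prop)
  have hsp : Ψ.symm (idProdProj G (p : Q × Q), (1 : G)) = p := by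
    rw [← hΨp]
    exact Ψ.left_inv hp
  have h1 : ∀ᶠ x in 𝓝 (idProdProj G (p : Q × Q)), (x, (1 : G)) ∈ Ψ.target :=
    ContinuousAt.preimage_mem_nhds (by fun_prop) (Ψ.open_target.mem_nhds hpt)
  have h2 : ∀ᶠ x in 𝓝 (idProdProj G (p : Q × Q)), Ψ.symm (x, (1 : G)) ∈ V :=
    hs.preimage_mem_nhds (by rwa [hsp])
  filter_upwards [h1, h2] with x hx1 hx2
  have hx := (hΨ _).symm.trans (Ψ.right_inv hx1)
  let q : {p ∈ U | A p = 1} := ⟨Ψ.symm (x, 1), hΨU (Ψ.map_target hx1), congrArg Prod.snd hx⟩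
  have hq : idProdProj G (q : Q × Q) = x := congrArg Prod.fst hx
  exact hq ▸ hVS (show q ∈ Subtype.val ⁻¹' V from hx2)

theorem isDiscreteConnection [FiniteDimensional ℝ EG] [FiniteDimensional ℝ EQ]
    [FiniteDimensional ℝ EB] [IG.Boundaryless] [IQ.Boundaryless] [IB.Boundaryless]
    [LieGroup IG ∞ G] [IsManifold IQ ∞ Q] [IsManifold IB ∞ (OrbitSpace G Q)]
    (hπ : IsPrincipalBundle IG IQ IB G Q) (hA : IsDiscreteConnectionForm IG IQ U A) :
    IsDiscreteConnection IQ IB G {p ∈ U | A p = 1} where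
  invariant g q₀ q₁ h :=
    ⟨hA.invariant g g _ _ h.1, by simp [hA.equivariant g g _ _ h.1, h.2]⟩
  diagonal q := ⟨hA.diagonal q, hA.normalized q⟩
  injective := hA.injOn_idProdProj
  submanifold := by
    have hφ := hA.isOpenEmbedding_idProdProj hπ
    let k := Module.finrank ℝ (EQ × EB)
    let LN : (EQ × EB) ≃L[ℝ] EuclideanSpace ℝ (Fin k) :=
      ContinuousLinearEquiv.ofFinrankEq (by simp [k])
    let D : ∀ y : Q × OrbitSpace G Q, PartialDiffeomorph (IQ.prod IB) (𝓡 k)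
        (Q × OrbitSpace G Q) (EuclideanSpace ℝ (Fin k)) ∞ := fun y =>
      (PartialDiffeomorph.extChart (IQ.prod IB) y).trans (PartialDiffeomorph.ofLinear LN ∞)
    have hD : ∀ y, y ∈ (D y).source := fun y => ⟨mem_extChartAt_source y, mem_univ _⟩
    let _ := hφ.chartedSpacePullback D hD
    have hM := hφ.isManifold_pullback D hD
    have hloc := hφ.isLocalDiffeomorph_pullback D hD
    refine ⟨k, _, hM, ⟨?_, .subtypeVal⟩, hloc⟩
    -- The normal directions to the level set are the values of `A`, so the complement is modelled
    -- on `EG`.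
    refine Manifold.IsImmersionOfComplement.isImmersion (F := EG) fun p => ?_
    obtain ⟨L⟩ := hπ.nonempty_continuousLinearEquiv p.1.1
    obtain ⟨Ψ, hp, -, hΨ⟩ := hA.exists_partialDiffeomorph hπ p.2.1
    refine Manifold.isImmersionAtOfComplement_of_slice continuous_subtype_val.continuousAt
      (hloc p) Ψ hp 1 (fun y _ => by rw [hΨ, y.2.2]) LN ?_
    -- `ℝᵏ × EG ≃ (EQ × EB) × EG ≃ EQ × (EB × EG) ≃ EQ × EQ`.
    exact ((LN.symm.prodCongr (.refl ℝ EG)).trans (.prodAssoc ℝ EQ EB EG)).trans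
      ((ContinuousLinearEquiv.refl ℝ EQ).prodCongr L.symm)

end IsDiscreteConnectionForm

end FormToConnection

end DiscreteConnection

end

theorem mainTheorem1
    {EG HG EQ HQ EB HB : Type*}
    [NormedAddCommGroup EG] [NormedSpace ℝ EG] [FiniteDimensional ℝ EG] [TopologicalSpace HG]
    [NormedAddCommGroup EQ] [NormedSpace ℝ EQ] [FiniteDimensional ℝ EQ] [TopologicalSpace HQ]
    [NormedAddCommGroup EB] [NormedSpace ℝ EB] [FiniteDimensional ℝ EB] [TopologicalSpace HB]
    (IG : ModelWithCorners ℝ EG HG) [IG.Boundaryless]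
    (IQ : ModelWithCorners ℝ EQ HQ) [IQ.Boundaryless]
    (IB : ModelWithCorners ℝ EB HB) [IB.Boundaryless]
    (G Q : Type*)
    [Group G] [TopologicalSpace G] [ChartedSpace HG G] [LieGroup IG ∞ G]
    [TopologicalSpace Q] [ChartedSpace HQ Q] [IsManifold IQ ∞ Q]
    [MulAction G Q] [ContMDiffSMul IG IQ ∞ G Q]
    [ChartedSpace HB (DiscreteConnection.OrbitSpace G Q)]
    [IsManifold IB ∞ (DiscreteConnection.OrbitSpace G Q)]
    (hπ : DiscreteConnection.IsPrincipalBundle IG IQ IB G Q) :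
    (∀ Hor : Set (Q × Q), DiscreteConnection.IsDiscreteConnection IQ IB G Hor →
      (∀ p ∈ DiscreteConnection.domain G Hor,
        ∃! g : G, DiscreteConnection.IsVerticalPart Hor p g) ∧
      DiscreteConnection.IsDiscreteConnectionForm IG IQ
        (DiscreteConnection.domain G Hor) (DiscreteConnection.form G Hor) ∧
      Hor = {p ∈ DiscreteConnection.domain G Hor | DiscreteConnection.form G Hor p = 1}) ∧
    (∀ (U : Set (Q × Q)) (A : Q × Q → G),
      DiscreteConnection.IsDiscreteConnectionForm IG IQ U A →
      DiscreteConnection.IsDiscreteConnection IQ IB G {p ∈ U | A p = 1} ∧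
      DiscreteConnection.domain G {p ∈ U | A p = 1} = U ∧
      Set.EqOn (DiscreteConnection.form G {p ∈ U | A p = 1}) A U) := by
  refine ⟨fun Hor hH => ⟨fun p hp => ?_, hH.isDiscreteConnectionForm hπ,
    hH.eq_setOf_form_eq_one hπ⟩, fun U A hA =>
      ⟨hA.isDiscreteConnection hπ, hA.domain_eq, hA.eqOn_form⟩⟩
  exact ⟨DiscreteConnection.form G Hor p,
    DiscreteConnection.isVerticalPart_iff.mpr (DiscreteConnection.form_mem hp),
    fun g hg => hH.eq_of_mem hπ hg.1 (DiscreteConnection.form_mem hp)⟩
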